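/- Let $k\ge 2$ and $n\ge k+17$ be integers, and let $G$ be a finite simple graph with $n$ vertices and $e(G)$ edges whose minimum degree is at least $k+1$. Suppose that $G$ is $(n+k-1)$-closed, i.e. there are no two distinct nonadjacent vertices $u,v$ of $G$ with $d_G(u)+d_G(v)\ge n+k-1$. Suppose also that $G$ is not $k$-leaf-connected, where a graph is called $k$-leaf-connected if it has at least $k+1$ vertices and every set $S$ of exactly $k$ of its vertices is precisely the set of leaves (vertices of degree one) of some spanning tree. If $$e(G)\ge \binom{n-3}{2}+3k+5,$$ then either the clique number of $G$ satisfies $\omega(G)=n-2$, or $G\cong K_4\vee(K_{n-7}+3K_1)$, where $+$ denotes disjoint union of graphs, $3K_1$ is the graph with three vertices and no edges, and $\vee$ denotes the join (the disjoint union together with all edges between the two vertex sets). -/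

import Mathlib

/-- `G` is `k`-leaf-connected: it has at least `k + 1` vertices and every set `S` of exactly `k`
vertices is the set of leaves (vertices of degree one) of some spanning tree `T` of `G`. A subgraph
`T ≤ G` on the same vertex type that is a tree is a spanning tree of `G`. -/
def SimpleGraph.IsLeafConnected {V : Type*} [Fintype V] (G : SimpleGraph V) (k : ℕ) : Prop :=
  k + 1 ≤ Fintype.card V ∧
    ∀ S : Finset V, S.card = k →
      ∃ T : SimpleGraph V, T ≤ G ∧ T.IsTree ∧ ∀ v : V, v ∈ S ↔ (T.neighborSet v).ncard = 1

/-- `G` is `l`-closed, that is, equal to its own `l`-closure: the process of joining nonadjacent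
pairs of distinct vertices with degree sum at least `l` stops immediately at `G`. -/
def SimpleGraph.IsDegreeClosed {V : Type*} [Fintype V] (G : SimpleGraph V) [DecidableRel G.Adj]
    (l : ℕ) : Prop :=
  ¬ ∃ u v : V, u ≠ v ∧ ¬ G.Adj u v ∧ l ≤ G.degree u + G.degree v

/-- The join `G ∨ H`: the disjoint union of `G` and `H` together with all edges between the two
vertex sets. -/
def SimpleGraph.joinGraph {V W : Type*} (G : SimpleGraph V) (H : SimpleGraph W) :
    SimpleGraph (V ⊕ W) :=
  (G ⊕g H) ⊔ completeBipartiteGraph V W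

/-- The graph `K₄ ∨ (Kₘ + 3K₁)`. -/
def exceptionalGraph (m : ℕ) : SimpleGraph (Fin 4 ⊕ (Fin m ⊕ Fin 3)) :=
  SimpleGraph.joinGraph (⊤ : SimpleGraph (Fin 4))
    ((⊤ : SimpleGraph (Fin m)) ⊕g (⊥ : SimpleGraph (Fin 3)))

/-! Work in the complement H with m = n - k. Closedness says that adjacent vertices of H have degree
sum at least m, the minimum degree bounds degrees in H by m - 2, and the edge count gives e(H) ≤ 3m
- 11. The vertices of H of degree at least m/2 form a vertex cover, and counting edges leaves it at
most three vertices (`exists_cover_or_eq_join`).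

A cover of size at most two gives G a clique on n - 2 vertices, and the degree conditions on H rule
out a larger one (`cliqueNum_eq_of_cover`). A cover of size three forces G to be K_{k+2} ∨
(K_{n-k-5} + 3K₁). For k = 2 this is the exceptional graph. For k ≥ 3 it is k-leaf-connected
(`isLeafConnected_of_hubs`), contrary to hypothesis. The required spanning trees are grown vertex by
vertex while tracking their leaves. -/

open Finset

/-! ### Growing trees with a controlled leaf set -/

/-- `G.TreeWithLeaves U L`: a tree in `G` with vertex set `U` and leaf set `L` can be grown from an
edge of `G` by successively attaching pendant vertices. -/
inductive SimpleGraph.TreeWithLeaves {V : Type*} [DecidableEq V] (G : SimpleGraph V) :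
    Finset V → Finset V → Prop
  | edge {a b : V} (h : G.Adj a b) : TreeWithLeaves G {a, b} {a, b}
  | extend {U L : Finset V} {u v : V} (h : TreeWithLeaves G U L) (hu : u ∈ U) (hv : v ∉ U)
      (huv : G.Adj u v) : TreeWithLeaves G (insert v U) (insert v (L.erase u))

namespace SimpleGraph

variable {V : Type*} [DecidableEq V] {G : SimpleGraph V}

theorem TreeWithLeaves.leaves_subset {U L : Finset V} (h : G.TreeWithLeaves U L) : L ⊆ U := by
  induction h with
  | edge h => exact subset_rfl
  | extend h hu hv huv ih => exact insert_subset_insert _ ((erase_subset _ _).trans ih)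

/-- Connectedness on `U` with one edge fewer than vertices yields a tree by counting. The clause
that no vertex of `U` is isolated is what makes `x` stop being a leaf once a pendant vertex is
attached to it. -/
theorem TreeWithLeaves.exists_subgraph [Finite V] {U L : Finset V} (h : G.TreeWithLeaves U L) :
    ∃ T : SimpleGraph V, T ≤ G ∧ (∀ u v, T.Adj u v → u ∈ U) ∧
      (∀ u ∈ U, ∀ v ∈ U, T.Reachable u v) ∧ T.edgeSet.ncard + 1 = U.card ∧
      (∀ v ∈ U, ∃ w, T.Adj v w) ∧ ∀ v ∈ U, v ∈ L ↔ (T.neighborSet v).ncard = 1 := by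
  induction h with
  | @edge a b h =>
    have hab := h.ne
    refine ⟨SimpleGraph.edge a b, ?_, ?_, ?_, ?_, ?_, ?_⟩
    · intro u v huv
      rw [edge_adj] at huv
      rcases huv with ⟨⟨rfl, rfl⟩ | ⟨rfl, rfl⟩, -⟩
      · exact h
      · exact h.symm
    · intro u v huv
      rw [edge_adj] at huv
      grind
    · have hr : (SimpleGraph.edge a b).Reachable a b :=
        Adj.reachable (by rw [edge_adj]; exact ⟨Or.inl ⟨rfl, rfl⟩, hab⟩)
      intro u hu v hv
      simp only [mem_insert, mem_singleton] at hu hv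
      rcases hu with rfl | rfl <;> rcases hv with rfl | rfl
      · exact Reachable.refl _
      · exact hr
      · exact hr.symm
      · exact Reachable.refl _
    · rw [edgeSet_edge_of_ne hab, Set.ncard_singleton, card_pair hab]
    · intro v hv
      simp only [mem_insert, mem_singleton] at hv
      rcases hv with rfl | rfl
      · exact ⟨b, by rw [edge_adj]; grind⟩
      · exact ⟨a, by rw [edge_adj]; grind⟩
    · intro v hv
      refine ⟨fun _ => ?_, fun _ => hv⟩
      simp only [mem_insert, mem_singleton] at hv
      rw [Set.ncard_eq_one]
      rcases hv with rfl | rfl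
      · exact ⟨b, by ext w; rw [mem_neighborSet, edge_adj, Set.mem_singleton_iff]; grind⟩
      · exact ⟨a, by ext w; rw [mem_neighborSet, edge_adj, Set.mem_singleton_iff]; grind⟩
  | @extend U L x y h hx hy hxy ih =>
    obtain ⟨T, hT, hU, hr, hc, hn, hl⟩ := ih
    have hne := hxy.ne
    have hadj : ∀ u v, (T ⊔ SimpleGraph.edge x y).Adj u v ↔
        T.Adj u v ∨ (u = x ∧ v = y) ∨ (u = y ∧ v = x) := by
      intro u v
      rw [sup_adj, edge_adj]
      grind
    have hyT : ∀ w, ¬ T.Adj y w := fun w hw => hy (hU _ _ hw)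
    have hyT' : ∀ w, ¬ T.Adj w y := fun w hw => hyT w hw.symm
    refine ⟨T ⊔ SimpleGraph.edge x y, ?_, ?_, ?_, ?_, ?_, ?_⟩
    · intro u v huv
      rcases (hadj u v).1 huv with h' | ⟨rfl, rfl⟩ | ⟨rfl, rfl⟩
      · exact hT h'
      · exact hxy
      · exact hxy.symm
    · intro u v huv
      rcases (hadj u v).1 huv with h' | ⟨rfl, rfl⟩ | ⟨rfl, rfl⟩
      · exact mem_insert_of_mem (hU _ _ h')
      · exact mem_insert_of_mem hx
      · exact mem_insert_self _ _
    · have hxy' : (T ⊔ SimpleGraph.edge x y).Reachable x y :=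
        Adj.reachable ((hadj _ _).2 (by simp))
      have key : ∀ u ∈ insert y U, (T ⊔ SimpleGraph.edge x y).Reachable x u := by
        intro u hu
        rcases mem_insert.1 hu with rfl | hu
        · exact hxy'
        · exact (hr x hx u hu).mono le_sup_left
      intro u hu v hv
      exact (key u hu).symm.trans (key v hv)
    · rw [edgeSet_sup, edgeSet_edge_of_ne hne, Set.union_singleton,
        Set.ncard_insert_of_notMem (fun h' => hyT' _ (T.mem_edgeSet.1 h')), hc,
        card_insert_of_notMem hy]
    · intro v hv
      rcases mem_insert.1 hv with rfl | hv
      · exact ⟨x, (hadj _ _).2 (by simp)⟩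
      · obtain ⟨w, hw⟩ := hn v hv
        exact ⟨w, (hadj _ _).2 (Or.inl hw)⟩
    · intro v hv
      by_cases hvy : v = y
      · subst hvy
        refine ⟨fun _ => ?_, fun _ => mem_insert_self _ _⟩
        rw [Set.ncard_eq_one]
        refine ⟨x, ?_⟩
        ext w
        rw [mem_neighborSet, hadj, Set.mem_singleton_iff]
        have := hyT w
        grind
      · have hvU : v ∈ U := (mem_insert.1 hv).resolve_left hvy
        by_cases hvx : v = x
        · subst hvx
          have hnb : (T ⊔ SimpleGraph.edge v y).neighborSet v = insert y (T.neighborSet v) := by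
            ext w
            rw [mem_neighborSet, hadj, Set.mem_insert_iff, mem_neighborSet]
            grind
          rw [hnb, Set.ncard_insert_of_notMem (show y ∉ T.neighborSet v from hyT' v)]
          obtain ⟨w, hw⟩ := hn v hvU
          have : (T.neighborSet v).ncard ≠ 0 :=
            Set.ncard_ne_zero_of_mem (a := w) hw
          simp [hvy, this]
        · have hnb : (T ⊔ SimpleGraph.edge x y).neighborSet v = T.neighborSet v := by
            ext w
            rw [mem_neighborSet, hadj, mem_neighborSet]
            grind
          rw [hnb, ← hl v hvU]
          simp [hvy, hvx]

theorem TreeWithLeaves.exists_spanningTree [Fintype V] {S : Finset V}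
    (h : G.TreeWithLeaves univ S) :
    ∃ T : SimpleGraph V, T ≤ G ∧ T.IsTree ∧ ∀ v : V, v ∈ S ↔ (T.neighborSet v).ncard = 1 := by
  obtain ⟨T, hT, -, hr, hc, -, hl⟩ := h.exists_subgraph
  refine ⟨T, hT, ?_, fun v => hl v (mem_univ v)⟩
  have hne : Nonempty V := by
    rw [← Fintype.card_pos_iff, ← card_univ]
    omega
  rw [isTree_iff_connected_and_card]
  refine ⟨⟨fun u v => hr u (mem_univ u) v (mem_univ v)⟩, ?_⟩
  rw [Nat.card_coe_set_eq, hc, card_univ, Nat.card_eq_fintype_card]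

/-- Attach all vertices of `W` as pendant vertices at the non-leaf `u`. -/
theorem TreeWithLeaves.hang {U L W : Finset V} {u : V} (h : G.TreeWithLeaves U L) (hu : u ∈ U)
    (huL : u ∉ L) (hW : Disjoint U W) (hadj : ∀ w ∈ W, G.Adj u w) :
    G.TreeWithLeaves (U ∪ W) (L ∪ W) := by
  induction W using Finset.induction_on with
  | empty => simpa using h
  | insert w W hw ih =>
    rw [disjoint_insert_right] at hW
    have h1 := ih hW.2 fun x hx => hadj x (mem_insert_of_mem hx)
    have huW : u ∉ W := fun h' => Finset.disjoint_left.1 hW.2 hu h'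
    have h2 := h1.extend (u := u) (v := w) (mem_union_left _ hu) (by simp [hW.1, hw])
      (hadj w (mem_insert_self _ _))
    convert h2 using 1
    · rw [union_insert]
    · rw [erase_eq_of_notMem (by simp [huL, huW]), union_insert]

/-- Grow a path from `u` through all vertices of `Z`, ending in the prescribed vertex `z`. -/
theorem TreeWithLeaves.path {U L Z : Finset V} {u z : V} (h : G.TreeWithLeaves U L) (hu : u ∈ U)
    (hZ : Disjoint U Z) (hz : z ∈ Z) (hclique : G.IsClique (insert u Z : Finset V)) :
    ∃ L', G.TreeWithLeaves (U ∪ Z) L' ∧ L'.erase z = L.erase u := by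
  induction Z using Finset.strongInduction generalizing z with
  | H Z ih =>
    have hLU := h.leaves_subset
    have hzU : z ∉ U := Finset.disjoint_right.1 hZ hz
    have huz : u ≠ z := fun h' => hzU (h' ▸ hu)
    -- Peel off the last vertex `z` and end the shorter path at any other `w`. Leaf sets are
    -- compared away from the two ends, since the start `u` may or may not have been a leaf.
    rcases (Z.erase z).eq_empty_or_nonempty with hE | ⟨w, hw⟩
    · have hZz : Z = {z} := by
        ext v
        have : v ∉ Z.erase z := by simp [hE]
        grind
      have h1 := h.extend (v := z) hu hzU (hclique (by simp) (by simp [hz]) huz)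
      refine ⟨_, by rwa [hZz, union_singleton], ?_⟩
      grind
    · have hwz := (mem_erase.1 hw).1
      have hwZ := (mem_erase.1 hw).2
      obtain ⟨L', h1, h2⟩ := ih (Z.erase z) (erase_ssubset hz)
        (hZ.mono_right (erase_subset _ _)) hw
        (hclique.subset (by
          rw [coe_subset]
          exact insert_subset_insert _ (erase_subset _ _)))
      have hL' := h1.leaves_subset
      have h3 := h1.extend (u := w) (v := z) (mem_union_right _ hw) (by simp [hzU])
        (hclique (by simp [hwZ]) (by simp [hz]) hwz)
      rw [← union_insert, insert_erase hz] at h3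
      refine ⟨_, h3, ?_⟩
      · rw [erase_insert_eq_erase, h2, erase_eq_of_notMem]
        grind

/-- Grow a path from `u` that alternates between `Y` and `D`. -/
theorem TreeWithLeaves.zigzag {U L Y D B : Finset V} {u : V} (h : G.TreeWithLeaves U L)
    (hu : u ∈ U) (huB : u ∈ B) (hB : ∀ b ∈ B, ∀ v, v ≠ b → G.Adj b v) (hDB : D ⊆ B)
    (hcard : Y.card = D.card) (hUY : Disjoint U Y) (hUD : Disjoint U D) (hYD : Disjoint Y D) :
    ∃ L', ∃ w ∈ U ∪ (Y ∪ D), w ∈ B ∧ G.TreeWithLeaves (U ∪ (Y ∪ D)) L' ∧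
      L'.erase w = L.erase u := by
  induction Y using Finset.induction_on generalizing D with
  | empty =>
    have : D = ∅ := by simpa [eq_comm] using hcard
    subst this
    exact ⟨L, u, by simpa using hu, huB, by simpa using h, rfl⟩
  | insert y Y hy ih =>
    have hDn : D.Nonempty := by
      rw [← card_pos, ← hcard, card_insert_of_notMem hy]
      omega
    obtain ⟨d, hd⟩ := hDn
    rw [disjoint_insert_right] at hUY
    rw [disjoint_insert_left] at hYD
    obtain ⟨L', w, hw, hwB, h1, h2⟩ := ih (D := D.erase d) ((erase_subset _ _).trans hDB)
      (by rw [card_insert_of_notMem hy] at hcard; rw [card_erase_of_mem hd]; omega)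
      hUY.2 (hUD.mono_right (erase_subset _ _)) (hYD.2.mono_right (erase_subset _ _))
    have hLU := h.leaves_subset
    have hL' := h1.leaves_subset
    have hyU : y ∉ U ∪ (Y ∪ D.erase d) := by
      simp [hUY.1, hy, hYD.1]
    have hdU : d ∉ U ∪ (Y ∪ D.erase d) := by
      simp [Finset.disjoint_right.1 hUD hd, Finset.disjoint_right.1 hYD.2 hd]
    have hyd : y ≠ d := fun h' => hYD.1 (h' ▸ hd)
    have h3 := h1.extend (u := w) (v := y) hw hyU (hB w hwB y fun h' => hyU (h' ▸ hw))
    have h4 := h3.extend (u := y) (v := d) (mem_insert_self _ _)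
      (by simp only [mem_insert, hdU, or_false]; exact hyd.symm)
      (hB d (hDB hd) y hyd).symm
    have hUU : insert d (insert y (U ∪ (Y ∪ D.erase d))) = U ∪ (insert y Y ∪ D) := by
      ext v
      by_cases hvd : v = d
      · simp [hvd, hd]
      · simp [hvd]
    rw [hUU] at h4
    refine ⟨_, d, by simp [hd], hDB hd, h4, ?_⟩
    rw [erase_insert_eq_erase, erase_insert_eq_erase, h2, erase_eq_of_notMem (a := y) (by grind),
      erase_eq_of_notMem (by grind)]

/-- Attach at `a` one path of length two through each vertex of `Y`, ending in the vertices
of `F`. -/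
theorem TreeWithLeaves.brooms {U L Y F B : Finset V} {a : V} (h : G.TreeWithLeaves U L)
    (ha : a ∈ U) (haB : a ∈ B) (hB : ∀ b ∈ B, ∀ v, v ≠ b → G.Adj b v) (hFB : F ⊆ B)
    (hcard : Y.card = F.card) (hUY : Disjoint U Y) (hUF : Disjoint U F) (hYF : Disjoint Y F) :
    ∃ L', G.TreeWithLeaves (U ∪ (Y ∪ F)) L' ∧ L'.erase a = L.erase a ∪ F := by
  induction Y using Finset.induction_on generalizing F with
  | empty =>
    have : F = ∅ := by simpa [eq_comm] using hcard
    subst this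
    exact ⟨L, by simpa using h, by simp⟩
  | insert y Y hy ih =>
    have hFn : F.Nonempty := by
      rw [← card_pos, ← hcard, card_insert_of_notMem hy]
      omega
    obtain ⟨d, hd⟩ := hFn
    rw [disjoint_insert_right] at hUY
    rw [disjoint_insert_left] at hYF
    obtain ⟨L', h1, h2⟩ := ih (F := F.erase d) ((erase_subset _ _).trans hFB)
      (by rw [card_insert_of_notMem hy] at hcard; rw [card_erase_of_mem hd]; omega)
      hUY.2 (hUF.mono_right (erase_subset _ _)) (hYF.2.mono_right (erase_subset _ _))
    have hL' := h1.leaves_subset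
    have hyU : y ∉ U ∪ (Y ∪ F.erase d) := by
      simp [hUY.1, hy, hYF.1]
    have hdU : d ∉ U ∪ (Y ∪ F.erase d) := by
      simp [Finset.disjoint_right.1 hUF hd, Finset.disjoint_right.1 hYF.2 hd]
    have hyd : y ≠ d := fun h' => hYF.1 (h' ▸ hd)
    have hay : y ≠ a := fun h' => hUY.1 (h' ▸ ha)
    have had : d ≠ a := fun h' => Finset.disjoint_right.1 hUF hd (h' ▸ ha)
    have h3 := h1.extend (u := a) (v := y) (mem_union_left _ ha) hyU (hB a haB y hay)
    have h4 := h3.extend (u := y) (v := d) (mem_insert_self _ _)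
      (by simp only [mem_insert, hdU, or_false]; exact hyd.symm)
      (hB d (hFB hd) y hyd).symm
    have hUU : insert d (insert y (U ∪ (Y ∪ F.erase d))) = U ∪ (insert y Y ∪ F) := by
      ext v
      by_cases hvd : v = d
      · simp [hvd, hd]
      · simp [hvd]
    rw [hUU] at h4
    refine ⟨_, h4, ?_⟩
    rw [erase_insert_eq_erase, erase_eq_of_notMem (a := y) (by grind), h2]
    ext v
    have := @h2
    simp only [Finset.ext_iff, mem_erase, mem_union] at this
    grind

/-- The path from `a` through one vertex of `Y` to one of `F` serves as the seed tree; the other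
branches are then attached at `a`. -/
theorem TreeWithLeaves.brooms_self {Y F B : Finset V} {a : V} (haB : a ∈ B)
    (hB : ∀ b ∈ B, ∀ v, v ≠ b → G.Adj b v) (hFB : F ⊆ B) (hcard : Y.card = F.card)
    (haY : a ∉ Y) (haF : a ∉ F) (hYF : Disjoint Y F) (hY : Y.Nonempty) :
    ∃ L, G.TreeWithLeaves (insert a (Y ∪ F)) L ∧ L.erase a = F := by
  obtain ⟨y, hy⟩ := hY
  obtain ⟨f, hf⟩ : F.Nonempty := by
    rw [← card_pos, ← hcard, card_pos]
    exact ⟨y, hy⟩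
  have hya : y ≠ a := fun h => haY (h ▸ hy)
  have hfa : f ≠ a := fun h => haF (h ▸ hf)
  have hfy : f ≠ y := fun h => Finset.disjoint_left.1 hYF hy (h ▸ hf)
  have h0 := TreeWithLeaves.edge (hB a haB y hya)
  have h1 := h0.extend (u := y) (v := f) (by simp) (by simp [hfa, hfy]) (hB f (hFB hf) y hfy.symm).symm
  have hYF' := Finset.disjoint_left.1 hYF
  obtain ⟨L, h2, h3⟩ := h1.brooms (Y := Y.erase y) (F := F.erase f) (a := a) (by simp) haB hB
    ((erase_subset _ _).trans hFB) (by rw [card_erase_of_mem hy, card_erase_of_mem hf, hcard])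
    (by rw [Finset.disjoint_left]; grind) (by rw [Finset.disjoint_left]; grind)
    (hYF.mono (erase_subset _ _) (erase_subset _ _))
  refine ⟨L, ?_, ?_⟩
  · convert h2 using 1
    ext v
    grind
  · rw [h3]
    ext v
    grind

/-! ### Leaf-connectedness of the complete graph and of the graph with hubs -/

/-- A spanning tree with leaf set `S`, given by a partition of the other vertices: `a` is a root,
the vertices of `Y₂` lie on branches of length two ending in `F`, and the vertices of `Y₁`, `D`
and `Z` lie on one further branch. -/
theorem exists_tree_of_partition [Fintype V] {B S Y₁ Y₂ D F Z : Finset V} {a z s₀ s₁ : V}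
    (hB : ∀ b ∈ B, ∀ v, v ≠ b → G.Adj b v) (haB : a ∈ B) (haS : a ∉ S)
    (hSc : Sᶜ = insert a (Y₂ ∪ (Y₁ ∪ D) ∪ Z)) (ha : a ∉ Y₂ ∪ (Y₁ ∪ D) ∪ Z)
    (hYY : Disjoint Y₁ Y₂) (hYD : Disjoint Y₁ D) (hYD' : Disjoint Y₂ D)
    (hZ : Disjoint (Y₂ ∪ (Y₁ ∪ D)) Z) (hDB : D ⊆ B) (hcD : Y₁.card = D.card)
    (hFB : F ⊆ B) (hFS : F ⊆ S) (hcF : Y₂.card = F.card) (hz : z ∈ Z)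
    (hclique : G.IsClique (Z : Set V)) (hs₁ : s₁ ∈ S) (hs₁F : s₁ ∉ F) (hadj : G.Adj z s₁)
    (hs₀ : s₀ ∈ S) (hs : s₀ ≠ s₁) :
    ∃ T : SimpleGraph V, T ≤ G ∧ T.IsTree ∧ ∀ v : V, v ∈ S ↔ (T.neighborSet v).ncard = 1 := by
  have hScv : ∀ v, v ∉ S ↔ v = a ∨ v ∈ Y₂ ∨ v ∈ Y₁ ∨ v ∈ D ∨ v ∈ Z := by
    intro v
    simpa using Finset.ext_iff.1 hSc v
  -- Without branches through `Y₂`, the edge from `a` to the leaf `s₀` is the seed. Either way `a`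
  -- has a branch besides the long one, so it ends up as a non-leaf.
  obtain ⟨F', L, h1, hL, hF'S, hs₁F'⟩ : ∃ F' L, G.TreeWithLeaves (insert a (Y₂ ∪ F')) L ∧
      L.erase a = F' ∧ F' ⊆ S ∧ s₁ ∉ F' := by
    rcases Y₂.eq_empty_or_nonempty with hE | hN
    · have hsa : s₀ ≠ a := fun h => haS (h ▸ hs₀)
      refine ⟨{s₀}, {a, s₀}, ?_, ?_, by simpa using hs₀, by simpa using hs.symm⟩
      · rw [hE, empty_union]
        exact TreeWithLeaves.edge (hB a haB s₀ hsa)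
      · ext v
        simp only [mem_erase, mem_insert, mem_singleton]
        grind
    · obtain ⟨L, h, h'⟩ := TreeWithLeaves.brooms_self haB hB hFB hcF (by grind)
        (fun h => haS (hFS h)) (by rw [Finset.disjoint_left]; grind) hN
      exact ⟨F, L, h, h', hFS, hs₁F⟩
  rw [Finset.disjoint_left] at hYY hYD hYD' hZ
  obtain ⟨L₁, w, hw, hwB, h2, hL₁⟩ := h1.zigzag (Y := Y₁) (D := D) (mem_insert_self _ _) haB hB hDB
    hcD (by rw [Finset.disjoint_left]; grind) (by rw [Finset.disjoint_left]; grind)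
    (Finset.disjoint_left.2 hYD)
  have hUZ : Disjoint (insert a (Y₂ ∪ F') ∪ (Y₁ ∪ D)) Z := by
    rw [Finset.disjoint_left]
    grind
  have hcl : G.IsClique (insert w Z : Finset V) := by
    rw [coe_insert]
    exact hclique.insert fun v _ hv => hB w hwB v hv.symm
  obtain ⟨L₂, h3, hL₂⟩ := h2.path hw hUZ hz hcl
  have hs₁U : s₁ ∉ insert a (Y₂ ∪ F') ∪ (Y₁ ∪ D) ∪ Z := by grind
  have h4 := h3.extend (mem_union_right _ hz) hs₁U hadj
  -- The ends `z`, `w`, `a` cancel in turn, leaving exactly `insert s₁ F'` as leaves; the rest of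
  -- `S` is hung at `a`.
  rw [hL₂, hL₁, hL] at h4
  have h5 := h4.hang (u := a) (W := S \ insert s₁ F') (by simp) (by grind)
    (by rw [Finset.disjoint_left]; grind) (fun v hv => hB a haB v (by grind))
  refine TreeWithLeaves.exists_spanningTree ?_
  convert h5 using 1
  · ext v
    have := hScv v
    simp only [mem_univ, true_iff]
    grind
  · ext v
    grind

theorem isLeafConnected_of_complete [Fintype V] {k : ℕ} (hk : 2 ≤ k) (hV : k + 2 ≤ Fintype.card V)
    (hG : ∀ u v, u ≠ v → G.Adj u v) : G.IsLeafConnected k := by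
  refine ⟨by omega, fun S hS => ?_⟩
  have hSc : 1 < Sᶜ.card := by
    rw [card_compl]
    omega
  obtain ⟨a, ha, z, hz, haz⟩ := one_lt_card.1 hSc
  obtain ⟨s₀, hs₀, s₁, hs₁, hs⟩ := one_lt_card.1 (show 1 < S.card by omega)
  rw [mem_compl] at ha hz
  exact exists_tree_of_partition (B := univ) (Y₁ := ∅) (Y₂ := ∅) (D := ∅) (F := ∅)
    (Z := Sᶜ.erase a) (fun b _ v hv => hG b v hv.symm) (mem_univ a) ha
    (by simp [insert_erase, ha]) (by simp) (by simp) (by simp) (by simp) (by simp) (by simp)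
    (by simp) (by simp) (by simp) (by simp) (z := z) (by simp [hz, haz.symm])
    (fun u _ v _ huv => hG u v huv) hs₁ (by simp) (hG _ _ fun h => hz (h ▸ hs₁)) hs₀ hs

/-- Vertices of `X` outside `S` must be internal, and each is given two hubs as neighbours. The work
is to ration the hubs inside and outside `S`. -/
theorem isLeafConnected_of_hubs [Fintype V] {k : ℕ} {B X : Finset V} (hk : 3 ≤ k)
    (hV : k + 8 ≤ Fintype.card V) (hBX : Disjoint B X) (hBc : B.card = k + 2) (hXc : X.card = 3)
    (hB : ∀ b ∈ B, ∀ v, v ≠ b → G.Adj b v) (hcl : ∀ u ∉ X, ∀ v ∉ X, u ≠ v → G.Adj u v) :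
    G.IsLeafConnected k := by
  refine ⟨by omega, fun S hS => ?_⟩
  have hBXv := Finset.disjoint_left.1 hBX
  have hScard : Sᶜ.card = Fintype.card V - k := by rw [card_compl, hS]
  have hXS : (X \ S).card + (S ∩ X).card = 3 := by
    rw [inter_comm, card_sdiff_add_card_inter, hXc]
  have hBS : (B \ S).card + (S ∩ B).card = k + 2 := by
    rw [inter_comm, card_sdiff_add_card_inter, hBc]
  have hSX : (S \ X).card + (S ∩ X).card = k := by rw [card_sdiff_add_card_inter, hS]
  have hSB : ((S \ X) \ B).card + (S ∩ B).card = (S \ X).card := by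
    rw [← card_sdiff_add_card_inter (S \ X) B]
    congr 2
    ext v
    grind
  set c := ((S \ X) \ B).card with hc
  rcases (X \ S).eq_empty_or_nonempty with hE | hN
  · rw [hE, card_empty] at hXS
    obtain ⟨a, ha, z, hz, haz⟩ := one_lt_card.1 (show 1 < (B \ S).card by omega)
    obtain ⟨s₀, hs₀, s₁, hs₁, hs⟩ := one_lt_card.1 (show 1 < S.card by omega)
    rw [mem_sdiff] at ha hz
    have hXsub : ∀ v, v ∈ X → v ∈ S := fun v hv => (sdiff_eq_empty_iff_subset.1 hE) hv
    refine exists_tree_of_partition (Y₁ := ∅) (Y₂ := ∅) (D := ∅) (F := ∅)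
      (Z := Sᶜ.erase a) hB ha.1 ha.2
      (by simp [insert_erase, ha.2]) (by simp) (by simp) (by simp) (by simp) (by simp) (by simp)
      (by simp) (by simp) (by simp) (by simp) (z := z) (by simp [hz.2, haz.symm])
      (fun u hu v hv huv => ?_) hs₁ (by simp) (hB _ hz.1 _ fun h => hz.2 (h ▸ hs₁)) hs₀ hs
    simp only [coe_erase, coe_compl, Set.mem_sdiff, Set.mem_compl_iff, mem_coe] at hu hv
    exact hcl u (fun h => hu.1 (hXsub u h)) v (fun h => hv.1 (hXsub v h)) huv
  · have hy := hN.card_pos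
    -- With y = |X \ S|, there are 5 - y + c hubs outside `S`, and the zigzag through j vertices of
    -- `X` uses j + 1 of them, counting `a`. The other y - j vertices need hubs in `S` as leaves,
    -- and one leaf outside `X` must remain as `s₁`. This choice of j meets all three demands; when
    -- y = 3 and c = 0, the last one is where k ≥ 3 is needed.
    obtain ⟨j, hj⟩ : ∃ j, j = min (X \ S).card (max 1 c) := ⟨_, rfl⟩
    obtain ⟨a, ha⟩ : (B \ S).Nonempty := by
      rw [← card_pos]
      omega
    obtain ⟨D, hD, hDc⟩ := exists_subset_card_eq (s := (B \ S).erase a) (n := j)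
      (by rw [card_erase_of_mem ha]; omega)
    obtain ⟨F, hF, hFc⟩ := exists_subset_card_eq (s := S ∩ B) (n := (X \ S).card - j) (by omega)
    obtain ⟨Y, hY, hYc⟩ := exists_subset_card_eq (s := X \ S) (n := j) (by omega)
    obtain ⟨z, hz⟩ : (Sᶜ \ insert a (X \ S ∪ D)).Nonempty := by
      rw [← card_pos]
      have h1 := le_card_sdiff (insert a (X \ S ∪ D)) Sᶜ
      have h2 := card_insert_le a (X \ S ∪ D)
      have h3 := card_union_le (X \ S) D
      omega
    obtain ⟨s₁, hs₁⟩ : ((S \ X) \ F).Nonempty := by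
      rw [← card_pos]
      have h1 := le_card_sdiff F (S \ X)
      omega
    obtain ⟨s₀, hs₀⟩ : (S.erase s₁).Nonempty := by
      rw [← card_pos]
      have h1 := pred_card_le_card_erase (s := S) (a := s₁)
      omega
    rw [mem_sdiff] at ha
    rw [mem_erase] at hs₀
    simp only [mem_sdiff] at hs₁
    have hD' : ∀ v ∈ D, v ≠ a ∧ v ∈ B ∧ v ∉ S := fun v hv => by simpa using hD hv
    have hF' : ∀ v ∈ F, v ∈ S ∧ v ∈ B := fun v hv => by simpa using hF hv
    have hY' : ∀ v ∈ Y, v ∈ X ∧ v ∉ S := fun v hv => by simpa using hY hv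
    have hZ' : ∀ v ∈ Sᶜ \ insert a (X \ S ∪ D), v ∉ X ∧ v ∉ S := by
      intro v hv
      simp only [mem_sdiff, mem_compl, mem_insert, mem_union, not_or, not_and, not_not] at hv
      exact ⟨fun h => hv.1 (hv.2.2.1 h), hv.1⟩
    have hz' := hZ' z hz
    refine exists_tree_of_partition (B := B) (Y₁ := Y) (Y₂ := (X \ S) \ Y) (D := D) (F := F)
      (Z := Sᶜ \ insert a (X \ S ∪ D)) hB ha.1 ha.2 ?_ ?_ ?_ ?_ ?_ ?_ (fun v hv => (hD' v hv).2.1)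
      (by omega) (fun v hv => (hF' v hv).2) (fun v hv => (hF' v hv).1) ?_ hz ?_ hs₁.1.1 hs₁.2
      (hcl z hz'.1 s₁ hs₁.1.2 fun h => hz'.2 (h ▸ hs₁.1.1)) hs₀.2 hs₀.1
    · ext v
      have h1 := hD' v
      have h2 := hY' v
      simp only [mem_compl, mem_insert, mem_union, mem_sdiff]
      by_cases hva : v = a
      · simp [hva, ha.2]
      · by_cases hvS : v ∈ S
        · have h3 : v ∉ D := fun h => (h1 h).2.2 hvS
          have h4 : v ∉ Y := fun h => (h2 h).2 hvS
          simp [hvS, hva, h3, h4]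
        · by_cases hvY : v ∈ Y
          · simp [hvS, hvY]
          · by_cases hvX : v ∈ X <;> by_cases hvD : v ∈ D <;> simp [hva, hvS, hvY, hvX, hvD]
    · have h1 : a ∉ D := fun h => (hD' a h).1 rfl
      have h2 : a ∉ Y := fun h => hBXv ha.1 (hY' a h).1
      simp [h1, h2, hBXv ha.1]
    · exact disjoint_sdiff
    · rw [Finset.disjoint_left]
      exact fun v h1 h2 => hBXv (hD' v h2).2.1 (hY' v h1).1
    · rw [Finset.disjoint_left]
      exact fun v h1 h2 => hBXv (hD' v h2).2.1 (mem_sdiff.1 (mem_sdiff.1 h1).1).1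
    · rw [Finset.disjoint_left]
      intro v h1 h2
      have h3 := hZ' v h2
      have h4 : v ∉ D := fun h => (mem_sdiff.1 h2).2 (by simp [h])
      have h5 : v ∉ Y := fun h => h3.1 (hY' v h).1
      simp [h3.1, h4, h5] at h1
    · rw [card_sdiff_of_subset hY]
      omega
    · intro u hu v hv huv
      rw [mem_coe] at hu hv
      exact hcl u (hZ' u hu).1 v (hZ' v hv).1 huv

/-! ### Degree counting and the structure of the complement -/

theorem degree_eq_card_filter_add [Fintype V] (H : SimpleGraph V) [DecidableRel H.Adj]
    (A : Finset V) (u : V) :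
    H.degree u = (A.filter (H.Adj u)).card + (Aᶜ.filter (H.Adj u)).card := by
  rw [← card_neighborFinset_eq_degree, neighborFinset_eq_filter, ← card_union_of_disjoint,
    ← filter_union, union_compl]
  exact disjoint_filter_filter disjoint_compl_right

/-- The degree sum over `A` counts inner edges twice and crossing edges once, and these edges
together number at most e(H). -/
theorem two_mul_sum_degree_le [Fintype V] (H : SimpleGraph V) [DecidableRel H.Adj]
    (A : Finset V) :
    2 * ∑ u ∈ A, H.degree u ≤
      2 * H.edgeFinset.card + ∑ u ∈ A, (A.filter (H.Adj u)).card := by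
  have h1 := H.sum_degrees_eq_twice_card_edges
  rw [← sum_add_sum_compl A] at h1
  have h2 : ∑ v ∈ Aᶜ, (A.filter (H.Adj v)).card ≤ ∑ v ∈ Aᶜ, H.degree v :=
    sum_le_sum fun v _ => by
      rw [degree_eq_card_filter_add H A v]
      exact Nat.le_add_right _ _
  have h3 : ∑ v ∈ Aᶜ, (A.filter (H.Adj v)).card = ∑ u ∈ A, (Aᶜ.filter (H.Adj u)).card := by
    simp only [card_filter]
    rw [sum_comm]
    simp only [H.adj_comm]
  have h4 : ∑ u ∈ A, H.degree u =
      ∑ u ∈ A, (A.filter (H.Adj u)).card + ∑ u ∈ A, (Aᶜ.filter (H.Adj u)).card := by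
    rw [← sum_add_distrib]
    exact sum_congr rfl fun u _ => degree_eq_card_filter_add H A u
  omega

theorem card_filter_adj_le (H : SimpleGraph V) [DecidableRel H.Adj] {A : Finset V} {u : V}
    (hu : u ∈ A) : (A.filter (H.Adj u)).card ≤ A.card - 1 := by
  rw [← card_erase_of_mem hu]
  refine card_le_card fun v hv => ?_
  rw [mem_filter] at hv
  exact mem_erase.2 ⟨hv.2.ne', hv.1⟩

theorem two_mul_sum_degree_le' [Fintype V] (H : SimpleGraph V) [DecidableRel H.Adj]
    (A : Finset V) :
    2 * ∑ u ∈ A, H.degree u ≤ 2 * H.edgeFinset.card + A.card * (A.card - 1) := by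
  refine (two_mul_sum_degree_le H A).trans (Nat.add_le_add_left ?_ _)
  rw [← smul_eq_mul]
  exact sum_le_card_nsmul _ _ _ fun u hu => card_filter_adj_le H hu

/-- A graph with few edges, bounded degrees and large degree sums along edges has a vertex cover
of size at most two, or its edges are those of `K₃ ∨ (m - 5)K₁`. -/
theorem exists_cover_or_eq_join [Fintype V] (H : SimpleGraph V) [DecidableRel H.Adj] {m : ℕ}
    (hm : 17 ≤ m) (hadj : ∀ u v, H.Adj u v → m ≤ H.degree u + H.degree v)
    (hmax : ∀ v, H.degree v + 2 ≤ m) (he : H.edgeFinset.card + 11 ≤ 3 * m) :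
    (∃ A : Finset V, A.card ≤ 2 ∧ ∀ u v, H.Adj u v → u ∈ A ∨ v ∈ A) ∨
    ∃ A T : Finset V, A.card = 3 ∧ T.card = m - 5 ∧ Disjoint A T ∧
      ∀ u v, H.Adj u v ↔ u ≠ v ∧ (u ∈ A ∧ (v ∈ A ∨ v ∈ T) ∨ v ∈ A ∧ u ∈ T) := by
  obtain ⟨A, hA⟩ : ∃ A : Finset V, ∀ v, v ∈ A ↔ m ≤ 2 * H.degree v :=
    ⟨univ.filter fun v => m ≤ 2 * H.degree v, fun v => by simp⟩
  have hcover : ∀ u v, H.Adj u v → u ∈ A ∨ v ∈ A := by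
    intro u v huv
    have := hadj u v huv
    rw [hA, hA]
    omega
  have hA8 : A.card ≤ 8 := by
    -- Nine such vertices would give 9m ≤ 2e(H) + 72 ≤ 6m + 50, which fails exactly from m = 17 on.
    by_contra! h
    obtain ⟨A', hA', hc⟩ := exists_subset_card_eq (s := A) (n := 9) h
    have h1 := two_mul_sum_degree_le' H A'
    have h2 : A'.card * m ≤ ∑ u ∈ A', 2 * H.degree u := by
      rw [← smul_eq_mul]
      exact card_nsmul_le_sum _ _ _ fun u hu => (hA u).1 (hA' hu)
    rw [← mul_sum] at h2
    rw [hc] at h1 h2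
    omega
  have hout : ∀ x ∉ A, H.degree x = (A.filter (H.Adj x)).card := by
    intro x hx
    rw [degree_eq_card_filter_add H A x, Nat.add_eq_left, card_eq_zero, filter_eq_empty_iff]
    intro v hv hxv
    rw [mem_compl] at hv
    exact (hcover x v hxv).elim hx hv
  have hdeg : ∀ u ∈ A, m ≤ H.degree u + A.card := by
    intro u hu
    have h1 := (hA u).1 hu
    have h2 := card_filter_adj_le H hu
    have h3 := degree_eq_card_filter_add H A u
    -- `u` has degree at least 9 but at most 7 neighbours in `A`. A neighbour `x` outside the cover
    -- has degree at most |A|.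
    obtain ⟨x, hx⟩ : (Aᶜ.filter (H.Adj u)).Nonempty := by
      rw [← card_pos]
      omega
    rw [mem_filter, mem_compl] at hx
    have h4 := hadj u x hx.2
    have h5 := card_filter_le A (H.Adj x)
    rw [hout x hx.1] at h4
    omega
  by_cases hA2 : A.card ≤ 2
  · exact Or.inl ⟨A, hA2, hcover⟩
  right
  have hA3 : A.card = 3 := by
    by_contra hne
    have h1 := two_mul_sum_degree_le' H A
    have h2 : A.card * (m - A.card) ≤ ∑ u ∈ A, H.degree u := by
      rw [← smul_eq_mul]
      exact card_nsmul_le_sum _ _ _ fun u hu => by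
        have := hdeg u hu
        omega
    obtain ⟨a, ha⟩ : ∃ a, a = A.card := ⟨_, rfl⟩
    rw [← ha] at h1 h2 hA2 hA8 hne
    have h4 : 4 ≤ a := by omega
    -- The bounds combine to (2a - 6)m ≤ 3a² - a - 22, false for 4 ≤ a ≤ 8 and m ≥ 17.
    interval_cases a <;> omega
  rw [hA3] at hdeg
  have hsum := two_mul_sum_degree_le H A
  obtain ⟨p, q, r, hpq, hpr, hqr, rfl⟩ := card_eq_three.1 hA3
  rw [sum_insert (by simp [hpq, hpr]), sum_pair hqr, sum_insert (by simp [hpq, hpr]),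
    sum_pair hqr] at hsum
  have hp := hdeg p (by simp)
  have hq := hdeg q (by simp)
  have hr := hdeg r (by simp)
  have hfp := card_filter_adj_le H (A := {p, q, r}) (u := p) (by simp)
  have hfq := card_filter_adj_le H (A := {p, q, r}) (u := q) (by simp)
  have hfr := card_filter_adj_le H (A := {p, q, r}) (u := r) (by simp)
  rw [hA3] at hfp hfq hfr
  have hfull : ∀ x ∉ ({p, q, r} : Finset V), ∀ u ∈ ({p, q, r} : Finset V), H.Adj x u →
      ∀ w ∈ ({p, q, r} : Finset V), H.Adj x w := by
    intro x hx u hu hxu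
    have hxd := hout x hx
    have h1 := hadj x u hxu
    have h2 := hmax u
    obtain ⟨s, hs, t, ht, hst⟩ := one_lt_card.1
      (show 1 < (({p, q, r} : Finset V).filter (H.Adj x)).card by omega)
    rw [mem_filter] at hs ht
    have h3 : 3 ≤ H.degree x := by
      have h4 := hadj x s hs.2
      have h5 := hadj x t ht.2
      have hs1 := hs.1
      have ht1 := ht.1
      simp only [mem_insert, mem_singleton] at hs1 ht1
      rcases hs1 with rfl | rfl | rfl <;> rcases ht1 with rfl | rfl | rfl <;>
        first | exact absurd rfl hst | omega
    have h6 := eq_of_subset_of_card_le (filter_subset (H.Adj x) ({p, q, r} : Finset V))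
      (by omega)
    intro w hw
    rw [← h6, mem_filter] at hw
    exact hw.2
  obtain ⟨T, hT⟩ : ∃ T, T = ({p, q, r} : Finset V)ᶜ.filter (H.Adj p) := ⟨_, rfl⟩
  have hTu : ∀ u ∈ ({p, q, r} : Finset V), ({p, q, r} : Finset V)ᶜ.filter (H.Adj u) = T := by
    intro u hu
    rw [hT]
    refine filter_congr fun x hx => ?_
    rw [mem_compl] at hx
    rw [H.adj_comm u, H.adj_comm p]
    exact ⟨fun h => hfull x hx u hu h p (by simp), fun h => hfull x hx p (by simp) h u hu⟩
  have hdp := degree_eq_card_filter_add H {p, q, r} p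
  have hdq := degree_eq_card_filter_add H {p, q, r} q
  have hdr := degree_eq_card_filter_add H {p, q, r} r
  rw [hTu _ (by simp)] at hdp hdq hdr
  have hcp : (({p, q, r} : Finset V).filter (H.Adj p)).card =
      (if H.Adj p q then 1 else 0) + (if H.Adj p r then 1 else 0) := by
    rw [card_filter, sum_insert (by simp [hpq, hpr]), sum_pair hqr]
    simp
  have hcq : (({p, q, r} : Finset V).filter (H.Adj q)).card =
      (if H.Adj p q then 1 else 0) + (if H.Adj q r then 1 else 0) := by
    rw [card_filter, sum_insert (by simp [hpq, hpr]), sum_pair hqr]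
    simp [H.adj_comm q p]
  have hcr : (({p, q, r} : Finset V).filter (H.Adj r)).card =
      (if H.Adj p r then 1 else 0) + (if H.Adj q r then 1 else 0) := by
    rw [card_filter, sum_insert (by simp [hpq, hpr]), sum_pair hqr]
    simp [H.adj_comm r p, H.adj_comm r q]
  -- All three share the outer neighbourhood `T`, so only |T| and the inner edges are free. Degrees
  -- of at least m - 3 against e(H) ≤ 3m - 11 leave just the triangle with |T| = m - 5.
  have hcomplete : (H.Adj p q ∧ H.Adj p r ∧ H.Adj q r) ∧ T.card = m - 5 := by
    by_cases h1 : H.Adj p q <;> by_cases h2 : H.Adj p r <;> by_cases h3 : H.Adj q r <;>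
      simp only [h1, h2, h3, if_true, if_false] at hcp hcq hcr <;>
      first
        | exact ⟨⟨h1, h2, h3⟩, by omega⟩
        | (exfalso; omega)
  obtain ⟨⟨h1, h2, h3⟩, hTc⟩ := hcomplete
  have hTA : ∀ v ∈ T, v ∉ ({p, q, r} : Finset V) := by
    intro v hv
    rw [hT, mem_filter, mem_compl] at hv
    exact hv.1
  have hAA : ∀ u ∈ ({p, q, r} : Finset V), ∀ v ∈ ({p, q, r} : Finset V), u ≠ v → H.Adj u v := by
    intro u hu v hv huv
    simp only [mem_insert, mem_singleton] at hu hv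
    rcases hu with rfl | rfl | rfl <;> rcases hv with rfl | rfl | rfl <;>
      first | exact absurd rfl huv | assumption | (rw [H.adj_comm]; assumption)
  have hAT : ∀ u ∈ ({p, q, r} : Finset V), ∀ v, v ∉ ({p, q, r} : Finset V) →
      (H.Adj u v ↔ v ∈ T) := by
    intro u hu v hv
    rw [← hTu u hu, mem_filter, mem_compl]
    exact ⟨fun h => ⟨hv, h⟩, fun h => h.2⟩
  refine ⟨{p, q, r}, T, hA3, hTc, Finset.disjoint_right.2 fun v hv => hTA v hv, fun u v => ?_⟩
  constructor
  · intro huv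
    refine ⟨huv.ne, ?_⟩
    by_cases hu : u ∈ ({p, q, r} : Finset V)
    · by_cases hv : v ∈ ({p, q, r} : Finset V)
      · exact Or.inl ⟨hu, Or.inl hv⟩
      · exact Or.inl ⟨hu, Or.inr ((hAT u hu v hv).1 huv)⟩
    · have hv := (hcover u v huv).resolve_left hu
      exact Or.inr ⟨hv, (hAT v hv u hu).1 huv.symm⟩
  · rintro ⟨huv, ⟨hu, hv | hv⟩ | ⟨hv, hu⟩⟩
    · exact hAA u hu v hv huv
    · exact (hAT u hu v (hTA v hv)).2 hv
    · exact ((hAT v hv u (hTA u hu)).2 hu).symm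

/-! ### Returning from the complement to the graph -/

theorem two_mul_card_edgeFinset_add_compl [Fintype V] (G : SimpleGraph V) [DecidableRel G.Adj] :
    2 * (G.edgeFinset.card + Gᶜ.edgeFinset.card) = Fintype.card V * (Fintype.card V - 1) := by
  rw [mul_add, ← sum_degrees_eq_twice_card_edges, ← sum_degrees_eq_twice_card_edges,
    ← sum_add_distrib, ← card_univ, ← smul_eq_mul, ← sum_const]
  refine sum_congr rfl fun v _ => ?_
  rw [degree_compl, card_univ]
  have := G.degree_lt_card_verts v
  omega

theorem nonempty_iso_exceptionalGraph {V : Type*} [Fintype V] {G : SimpleGraph V} {t : ℕ} {B T A : Finset V}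
    (hB : B.card = 4) (hT : T.card = t) (hA : A.card = 3) (hBT : Disjoint B T)
    (hBA : Disjoint B A) (hTA : Disjoint T A) (hV : Fintype.card V = t + 7)
    (hG : ∀ u v, G.Adj u v ↔ u ≠ v ∧ ¬ (u ∈ A ∧ (v ∈ A ∨ v ∈ T) ∨ v ∈ A ∧ u ∈ T)) :
    Nonempty (G ≃g exceptionalGraph t) := by
  let eB := B.equivFinOfCardEq hB
  let eT := T.equivFinOfCardEq hT
  let eA := A.equivFinOfCardEq hA
  let g : Fin 4 ⊕ (Fin t ⊕ Fin 3) → V :=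
    Sum.elim (fun i => eB.symm i) (Sum.elim (fun i => eT.symm i) fun i => eA.symm i)
  have hgB : ∀ i, (eB.symm i : V) ∈ B := fun i => (eB.symm i).2
  have hgT : ∀ i, (eT.symm i : V) ∈ T := fun i => (eT.symm i).2
  have hgA : ∀ i, (eA.symm i : V) ∈ A := fun i => (eA.symm i).2
  rw [Finset.disjoint_left] at hBT hBA hTA
  have hBT' : ∀ i j, (eB.symm i : V) ≠ eT.symm j := fun i j h => hBT (hgB i) (h ▸ hgT j)
  have hBA' : ∀ i j, (eB.symm i : V) ≠ eA.symm j := fun i j h => hBA (hgB i) (h ▸ hgA j)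
  have hTA' : ∀ i j, (eT.symm i : V) ≠ eA.symm j := fun i j h => hTA (hgT i) (h ▸ hgA j)
  have hgB₁ : ∀ i, (eB.symm i : V) ∉ T := fun i => hBT (hgB i)
  have hgB₂ : ∀ i, (eB.symm i : V) ∉ A := fun i => hBA (hgB i)
  have hgT₁ : ∀ i, (eT.symm i : V) ∉ A := fun i => hTA (hgT i)
  have hginj : Function.Injective g := by
    rintro (i | i | i) (j | j | j) h
    · simpa [g, Subtype.coe_inj] using h
    · exact absurd h (hBT' i j)
    · exact absurd h (hBA' i j)
    · exact absurd h.symm (hBT' j i)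
    · simpa [g, Subtype.coe_inj] using h
    · exact absurd h (hTA' i j)
    · exact absurd h.symm (hBA' j i)
    · exact absurd h.symm (hTA' j i)
    · simpa [g, Subtype.coe_inj] using h
  have hgbij : Function.Bijective g := by
    rw [Fintype.bijective_iff_injective_and_card]
    refine ⟨hginj, ?_⟩
    simp only [Fintype.card_sum, Fintype.card_fin]
    omega
  refine ⟨RelIso.symm ⟨Equiv.ofBijective g hgbij, ?_⟩⟩
  intro x y
  change G.Adj (g x) (g y) ↔ (exceptionalGraph t).Adj x y
  rw [hG, hginj.ne_iff]
  rcases x with i | i | i <;> rcases y with j | j | j <;>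
    simp [g, exceptionalGraph, joinGraph, hgB₁, hgB₂, hgT₁, hgT, hgA]

/-- The complement of a cover is a clique. If a clique missed at most one vertex, every edge of `Gᶜ`
would have an end of degree at most 1, hence degree sum at most m - 1. -/
theorem cliqueNum_eq_of_cover [Fintype V] {G : SimpleGraph V} [DecidableRel G.Adj] {m : ℕ}
    (hm : ∀ u v, Gᶜ.Adj u v → m ≤ Gᶜ.degree u + Gᶜ.degree v) (hmax : ∀ v, Gᶜ.degree v + 2 ≤ m)
    (hG : ∃ u v, Gᶜ.Adj u v) {A : Finset V} (hA : A.card ≤ 2)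
    (hcover : ∀ u v, Gᶜ.Adj u v → u ∈ A ∨ v ∈ A) : G.cliqueNum = Fintype.card V - 2 := by
  apply le_antisymm
  · obtain ⟨s, hs⟩ := G.exists_isNClique_cliqueNum
    by_contra! hlt
    have hsc : sᶜ.card ≤ 1 := by
      rw [card_compl, hs.card_eq]
      omega
    have hdeg : ∀ v ∈ s, Gᶜ.degree v ≤ 1 := by
      intro v hv
      refine le_trans ?_ hsc
      rw [← card_neighborFinset_eq_degree]
      refine card_le_card fun w hw => ?_
      rw [mem_neighborFinset, compl_adj] at hw
      exact mem_compl.2 fun hws => hw.2 (hs.isClique hv hws hw.1)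
    obtain ⟨u, v, huv⟩ := hG
    have h1 := hm u v huv
    have h2 := hmax u
    have h3 := hmax v
    by_cases hu : u ∈ s
    · have := hdeg u hu
      omega
    · by_cases hv : v ∈ s
      · have := hdeg v hv
        omega
      · exact huv.ne (card_le_one.1 hsc u (mem_compl.2 hu) v (mem_compl.2 hv))
  · have hcl : G.IsClique (Aᶜ : Finset V) := by
      intro u hu v hv huv
      rw [mem_coe, mem_compl] at hu hv
      by_contra h
      exact (hcover u v ((compl_adj _ _ _).2 ⟨huv, h⟩)).elim hu hv
    have h1 := hcl.card_le_cliqueNum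
    rw [card_compl] at h1
    omega

end SimpleGraph

/-! ### The main theorem -/

theorem lemma3p1 {V : Type*} [Fintype V] [DecidableEq V] (G : SimpleGraph V) [DecidableRel G.Adj]
    (n k : ℕ) (hn : Fintype.card V = n) (hk : 2 ≤ k) (hnk : k + 17 ≤ n)
    (hclosed : G.IsDegreeClosed (n + k - 1))
    (hleaf : ¬ G.IsLeafConnected k)
    (hδ : k + 1 ≤ G.minDegree)
    (he : (n - 3).choose 2 + 3 * k + 5 ≤ G.edgeFinset.card) :
    G.cliqueNum = n - 2 ∨ Nonempty (G ≃g exceptionalGraph (n - 7)) := by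
  have hdeg : ∀ v, Gᶜ.degree v + G.degree v + 1 = n := by
    intro v
    rw [SimpleGraph.degree_compl]
    have := G.degree_lt_card_verts v
    omega
  have hadj : ∀ u v, Gᶜ.Adj u v → n - k ≤ Gᶜ.degree u + Gᶜ.degree v := by
    intro u v huv
    rw [SimpleGraph.compl_adj] at huv
    have h1 := hdeg u
    have h2 := hdeg v
    by_contra h
    exact hclosed ⟨u, v, huv.1, huv.2, by omega⟩
  have hmax : ∀ v, Gᶜ.degree v + 2 ≤ n - k := by
    intro v
    have h1 := hdeg v
    have h2 := G.minDegree_le_degree v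
    omega
  -- C(n,2) - C(n-3,2) = 3n - 6, so at most 3n - 6 - 3k - 5 edges are missing.
  have hedge : Gᶜ.edgeFinset.card + 11 ≤ 3 * (n - k) := by
    have h1 := G.two_mul_card_edgeFinset_add_compl
    rw [hn] at h1
    obtain ⟨t, rfl⟩ : ∃ t, n = t + 4 := ⟨n - 4, by omega⟩
    have h2 : 2 * (t + 4 - 3).choose 2 = (t + 1) * t := by
      rw [show t + 4 - 3 = t + 1 by omega, Nat.choose_two_right, Nat.add_sub_cancel,
        Nat.mul_div_cancel' (by rw [mul_comm]; exact Nat.two_dvd_mul_add_one t)]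
    have h3 : (t + 4) * (t + 4 - 1) = (t + 1) * t + 6 * t + 12 := by
      rw [show t + 4 - 1 = t + 3 by omega]
      ring
    omega
  have hne : ∃ u v, Gᶜ.Adj u v := by
    by_contra! h
    refine hleaf (SimpleGraph.isLeafConnected_of_complete hk (by omega) fun u v huv => ?_)
    by_contra h'
    exact h u v ((SimpleGraph.compl_adj _ _ _).2 ⟨huv, h'⟩)
  rcases Gᶜ.exists_cover_or_eq_join (by omega) hadj hmax hedge with
    ⟨A, hA, hcover⟩ | ⟨A, T, hA, hT, hAT, hH⟩
  · left
    rw [SimpleGraph.cliqueNum_eq_of_cover hadj hmax hne hA hcover, hn]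
  · right
    have hG : ∀ u v, G.Adj u v ↔ u ≠ v ∧ ¬ (u ∈ A ∧ (v ∈ A ∨ v ∈ T) ∨ v ∈ A ∧ u ∈ T) := by
      intro u v
      have h := hH u v
      rw [SimpleGraph.compl_adj] at h
      constructor
      · intro huv
        exact ⟨huv.ne, fun h' => (h.2 ⟨huv.ne, h'⟩).2 huv⟩
      · rintro ⟨huv, h'⟩
        by_contra hn
        exact h' (h.1 ⟨huv, hn⟩).2
    have hB : (A ∪ T)ᶜ.card = k + 2 := by
      rw [card_compl, card_union_of_disjoint hAT, hA, hT]
      omega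
    have hBA : Disjoint (A ∪ T)ᶜ A := disjoint_compl_left.mono_right subset_union_left
    have hBT : Disjoint (A ∪ T)ᶜ T := disjoint_compl_left.mono_right subset_union_right
    obtain rfl | hk3 : k = 2 ∨ 3 ≤ k := by omega
    · exact SimpleGraph.nonempty_iso_exceptionalGraph hB (by omega) hA hBT hBA hAT.symm
        (by omega) hG
    · refine absurd (SimpleGraph.isLeafConnected_of_hubs hk3 (by omega) hBA hB hA ?_ ?_) hleaf
      · intro b hb v hv
        rw [mem_compl, mem_union, not_or] at hb
        exact (hG b v).2 ⟨hv.symm, by simp [hb.1, hb.2]⟩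
      · intro u hu v hv huv
        exact (hG u v).2 ⟨huv, by simp [hu, hv]⟩
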